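/- Let $S$ be a finite nonempty alphabet, let $S^{\mathbb Z}$ carry the product topology (with $S$ discrete), and let $f:S^{\mathbb Z}\to S^{\mathbb Z}$ be any function. *Definitions.* A *block rule* is a map $\chi:S^n\to S^n$; $\chi^i:S^{\mathbb Z}\to S^{\mathbb Z}$ applies it to the block $x_{[i,i+n)}$ and leaves all other cells unchanged. Put $\chi^{i+}(x)=\lim_{k\to\infty}\chi^{i+k}\circ\cdots\circ\chi^{i+1}\circ\chi^{i}(x)$ and $\chi^{i-}(x)=\lim_{k\to\infty}\chi^{i-k}\circ\cdots\circ\chi^{i-2}\circ\chi^{i-1}(x)$ (these limits always exist). A bijective block rule $\chi$ with inverse $\xi$ defines the *slider relation* consisting of all pairs $(\xi^{i-}(x),\chi^{i+}(x))$ with $x\in S^{\mathbb Z}$, $i\in\mathbb Z$. The function $f$ is a *slider* if the slider relation of some bijective block rule (of some block length) is the graph of $f$. The function $f$ is a *cellular automaton* if there are $r\in\mathbb N$ and $f_{\mathrm{loc}}:S^{2r+1}\to S$ with $f(x)_i=f_{\mathrm{loc}}(x_{i-r},\dots,x_{i+r})$ for all $x$ and $i$. It is *left-closing* if $f(y)\neq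 f(y')$ whenever $y\neq y'$ and $y_{[i,\infty)}=y'_{[i,\infty)}$ for some $i\in\mathbb Z$. A *right stair* of length $3m$ is a pair $(v,w)\in S^{2m}\times S^{2m}$ for which there are $i\in\mathbb Z$, a right-infinite word $y\in S^{[i+3m,\infty)}$, a left-infinite word $z\in S^{(-\infty,i)}$ and a configuration $x\in S^{\mathbb Z}$ with $x_{[i+m,\infty)}=vy$ and $f(x)_{(-\infty,i+2m)}=zw$; $\Psi_{3m}$ is the set of all right stairs of length $3m$. Finally, $\lambda_f=\lim_{m\to\infty}|\Psi_{3m}|/|S|^{3m}$, and $v_p$ is the $p$-adic valuation on $\mathbb Q$. **Theorem.** If $f$ is a left-closing cellular automaton, then the limit $\lambda_f$ exists and is reached in finite time, i.e. $|\Psi_{3m}|/|S|^{3m}=\lambda_f$ for all sufficiently large $m$; in particular $\lambda_f$ is a positive rational number. Moreover, $f$ is a slider if and only if $f$ is a left-closing cellular automaton and $v_p(\lambda_f)\le 0$ for every prime $p$. -/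

import Mathlib

open Filter Topology

namespace SliderCA

/-- A block rule `χ : S^n → S^n` applied to the configuration `x` at coordinate `i`: the block
`x_[i, i+n)` is replaced by its image under `χ`, all other cells are unchanged. -/
def applyAt {S : Type*} {n : ℕ} (χ : (Fin n → S) → (Fin n → S)) (i : ℤ) (x : ℤ → S) : ℤ → S :=
  fun j =>
    if h : i ≤ j ∧ j < i + (n : ℤ) then
      χ (fun k => x (i + ((k : ℕ) : ℤ))) ⟨(j - i).toNat, by omega⟩
    else x j

/-- The finite left-to-right sweep over `[i, i+k)`: apply `χ` at `i`, then at `i+1`, ..., and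
finally at `i+k-1`. -/
def sweepRight {S : Type*} {n : ℕ} (χ : (Fin n → S) → (Fin n → S)) (i : ℤ) :
    ℕ → (ℤ → S) → (ℤ → S)
  | 0, x => x
  | k + 1, x => applyAt χ (i + (k : ℤ)) (sweepRight χ i k x)

/-- The finite right-to-left sweep over `[i-k, i)`: apply `ξ` at `i-1`, then at `i-2`, ..., and
finally at `i-k`. -/
def sweepLeft {S : Type*} {n : ℕ} (ξ : (Fin n → S) → (Fin n → S)) (i : ℤ) :
    ℕ → (ℤ → S) → (ℤ → S)
  | 0, x => x
  | k + 1, x => applyAt ξ (i - ((k : ℤ) + 1)) (sweepLeft ξ i k x)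

/-- The slider relation of a bijective block rule `χ` with inverse `ξ`: the pair `(y, z)` is in it
iff for some configuration `x` and some coordinate `i`, the right-to-left sweeps of `ξ` from `x`
starting at `i` converge to `y` and the left-to-right sweeps of `χ` from `x` starting at `i`
converge to `z` (in the product topology of `ℤ → S`). -/
def SliderRel {S : Type*} [TopologicalSpace S] {n : ℕ} (χ : Equiv.Perm (Fin n → S))
    (y z : ℤ → S) : Prop :=
  ∃ (x : ℤ → S) (i : ℤ),
    Tendsto (fun k : ℕ => sweepLeft χ.symm i k x) atTop (𝓝 y) ∧
      Tendsto (fun k : ℕ => sweepRight χ i k x) atTop (𝓝 z)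

/-- `f` is a slider: the slider relation of some bijective block rule is (the graph of) `f`. -/
def IsSlider {S : Type*} [TopologicalSpace S] (f : (ℤ → S) → (ℤ → S)) : Prop :=
  ∃ (n : ℕ) (χ : Equiv.Perm (Fin n → S)), ∀ y z : ℤ → S, SliderRel χ y z ↔ f y = z

/-- `f` is a cellular automaton: it is given by a local rule of some radius `r`. -/
def IsCellularAutomaton {S : Type*} (f : (ℤ → S) → (ℤ → S)) : Prop :=
  ∃ (r : ℕ) (loc : (Fin (2 * r + 1) → S) → S), ∀ (x : ℤ → S) (i : ℤ),
    f x i = loc (fun k => x (i - (r : ℤ) + ((k : ℕ) : ℤ)))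

/-- Two configurations are right-asymptotic if they agree on some `[i, ∞)`. -/
def RightAsymptotic {S : Type*} (y y' : ℤ → S) : Prop :=
  ∃ i : ℤ, ∀ j : ℤ, i ≤ j → y j = y' j

/-- `f` is left-closing: distinct right-asymptotic configurations have distinct images. -/
def IsLeftClosing {S : Type*} (f : (ℤ → S) → (ℤ → S)) : Prop :=
  ∀ y y' : ℤ → S, RightAsymptotic y y' → y ≠ y' → f y ≠ f y'

/-- The right stairs `(v, w)` of length `3m` connecting `(y, z)`, where `y` is a right-infinite
word on `[i+3m, ∞)` and `z` a left-infinite word on `(-∞, i)`: some configuration `x` satisfies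
`x_[i+m, ∞) = v y` and `f(x)_(-∞, i+2m) = z w`. -/
def rightStairsConnecting {S : Type*} (f : (ℤ → S) → (ℤ → S)) (m : ℕ) (i : ℤ)
    (y : Set.Ici (i + 3 * (m : ℤ)) → S) (z : Set.Iio i → S) :
    Set ((Fin (2 * m) → S) × (Fin (2 * m) → S)) :=
  {vw | ∃ x : ℤ → S,
    (∀ k : Fin (2 * m), x (i + (m : ℤ) + ((k : ℕ) : ℤ)) = vw.1 k) ∧
    (∀ j : Set.Ici (i + 3 * (m : ℤ)), x j = y j) ∧
    (∀ j : Set.Iio i, f x j = z j) ∧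
    (∀ k : Fin (2 * m), f x (i + ((k : ℕ) : ℤ)) = vw.2 k)}

/-- The set `Ψ_{3m}` of all right stairs of length `3m`. -/
def rightStairs {S : Type*} (f : (ℤ → S) → (ℤ → S)) (m : ℕ) :
    Set ((Fin (2 * m) → S) × (Fin (2 * m) → S)) :=
  {vw | ∃ (i : ℤ) (y : Set.Ici (i + 3 * (m : ℤ)) → S) (z : Set.Iio i → S),
    vw ∈ rightStairsConnecting f m i y z}

/-- The ratio `|Ψ_{3m}| / |S|^{3m}`. -/
noncomputable def stairRatio {S : Type*} (f : (ℤ → S) → (ℤ → S)) (m : ℕ) : ℚ :=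
  ((rightStairs f m).ncard : ℚ) / (Nat.card S : ℚ) ^ (3 * m)

/-- `λ_f`, the limit of `|Ψ_{3m}| / |S|^{3m}` as `m → ∞`. -/
noncomputable def stairLimit {S : Type*} (f : (ℤ → S) → (ℤ → S)) : ℚ :=
  limUnder atTop (stairRatio f)

end SliderCA

namespace SliderCA

/-! A right stair is a finite window on the pair `(x, f x)`: cells of `x` on `[i + m, i + 3m)` and
cells of `f x` on `[i, i + 2m)`. When `m` exceeds the radius, a stair at `i` and the next cell `x (i
+ 3m)` determine the output `f x i` and the stair at `i + 1`. This gives a map `stairStep` from `Ψ ×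
S` to `S × Ψ`, two finite sets of equal size, so injective, surjective and bijective are the same
for it. Injectivity for one such `m` makes `f` left-closing (run the step backwards), and by
compactness a left-closing `f` has it for all large `m`. Surjectivity lets every stair be joined to
an arbitrary right tail of `x` and an arbitrary left tail of `f x`. Hence `|Ψ|` grows by exactly
`|S| ^ 3` when `m` grows by one, and the ratio is eventually constant.

For a slider, let the sweeps start at `i`. The block of length `3m` at `i` then determines the stair
there, and one application of `χ` covers `stairStep`. The step therefore is surjective, and it
carries fibres of blocks over one stair bijectively to fibres over the next. Any two stairs can be
steered to a common one, so all fibres have the same size (`SlidesAlong.card_fiber_eq`) and `|Ψ|`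
divides `|S| ^ (3m)`, which bounds the valuations of the limit.

Conversely, if `|Ψ|` divides `|S| ^ (3m)`, a bijection of `S ^ (3m)` with `Ψ × C` stores a stair
together with an inert label in each block. Performing `stairStep` on the stored stair is a
bijective block rule of length `3m + 1` whose sweeps write `f x` to the right and restore `x` to the
left (`HasRadius.slidesAlong_stepRule`). -/

variable {S : Type*} {f : (ℤ → S) → (ℤ → S)} {m n r : ℕ}

/-! ### Cellular automata via a radius and shift-invariance -/

/-- `f` commutes with the shifts and `f x i` depends only on the cells of `x` at distance at most
`r` from `i`. -/
structure HasRadius (f : (ℤ → S) → (ℤ → S)) (r : ℕ) : Prop where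
  congr : ∀ (x y : ℤ → S) (i : ℤ), (∀ j, i - r ≤ j → j ≤ i + r → x j = y j) → f x i = f y i
  shift : ∀ (t : ℤ) (x : ℤ → S) (i : ℤ), f (fun j => x (j + t)) i = f x (i + t)

theorem IsCellularAutomaton.exists_hasRadius (h : IsCellularAutomaton f) :
    ∃ r, HasRadius f r := by
  obtain ⟨r, loc, h⟩ := h
  refine ⟨r, fun x y i hxy => ?_, fun t x i => ?_⟩
  · rw [h, h]
    congr 1
    funext k
    exact hxy _ (by omega) (by omega)
  · rw [h, h]
    congr 1
    funext k
    congr 1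
    ring

theorem HasRadius.isCellularAutomaton (h : HasRadius f r) : IsCellularAutomaton f := by
  -- The local rule evaluates `f` on a periodic extension of the window; reduction modulo `2 * r +
  -- 1` only makes the index total and is trivial on `[-r, r]`.
  refine ⟨r, fun u => f (fun j => u ⟨(j + r).toNat % (2 * r + 1), Nat.mod_lt _ (by omega)⟩) 0,
    fun x i => ?_⟩
  have h0 := h.shift i x 0
  rw [zero_add] at h0
  rw [← h0]
  refine h.congr _ _ _ fun j hj hj' => ?_
  have : (((j + r).toNat % (2 * r + 1) : ℕ) : ℤ) = j + r := by
    rw [Nat.mod_eq_of_lt (by omega)]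
    omega
  simp only [this]
  congr 1
  ring

theorem HasRadius.continuous [Finite S] [TopologicalSpace S] [DiscreteTopology S]
    (h : HasRadius f r) : Continuous f := by
  obtain ⟨r, loc, h⟩ := h.isCellularAutomaton
  refine continuous_pi fun i => ?_
  simp only [h]
  exact (continuous_of_discreteTopology (f := loc)).comp
    (continuous_pi fun k => continuous_apply _)

/-- A decreasing sequence of nonempty closed subsets of a compact space has a common point. -/
theorem exists_mem_of_antitone {X : Type*} [TopologicalSpace X] [CompactSpace X] (K : ℕ → Set X)
    (hK : ∀ k, K (k + 1) ⊆ K k) (hne : ∀ k, (K k).Nonempty) (hc : ∀ k, IsClosed (K k)) :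
    ∃ x, ∀ k, x ∈ K k := by
  obtain ⟨x, hx⟩ := IsCompact.nonempty_iInter_of_sequence_nonempty_isCompact_isClosed K hK hne
    (hc 0).isCompact hc
  exact ⟨x, Set.mem_iInter.1 hx⟩

theorem isClosed_setOf_ne {X Y : Type*} [TopologicalSpace X] [TopologicalSpace Y]
    [DiscreteTopology Y] {g g' : X → Y} (hg : Continuous g) (hg' : Continuous g') :
    IsClosed {x | g x ≠ g' x} :=
  (isClosed_discrete {q : Y × Y | q.1 ≠ q.2}).preimage (hg.prodMk hg')

/-- Compactness, as in the Curtis–Hedlund–Lyndon theorem: pairs violating radius `r` form a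
decreasing sequence of closed sets, and a common point would be two equal configurations with
different values. -/
theorem exists_radius_of_continuous [Finite S] [TopologicalSpace S] [DiscreteTopology S]
    (g : (ℤ → S) → S) (hg : Continuous g) :
    ∃ r : ℕ, ∀ x y : ℤ → S, (∀ j, -(r : ℤ) ≤ j → j ≤ r → x j = y j) → g x = g y := by
  by_contra! hcon
  obtain ⟨p, hp⟩ := exists_mem_of_antitone
    (fun r : ℕ => {p : (ℤ → S) × (ℤ → S) |
      (∀ j, -(r : ℤ) ≤ j → j ≤ r → p.1 j = p.2 j) ∧ g p.1 ≠ g p.2})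
    (fun r p hp => ⟨fun j h1 h2 => hp.1 j (by push_cast; omega) (by push_cast; omega), hp.2⟩)
    (fun r => by
      obtain ⟨x, y, h⟩ := hcon r
      exact ⟨(x, y), h⟩)
    (fun r => by
      have h1 : ∀ j : ℤ, IsClosed {p : (ℤ → S) × (ℤ → S) | p.1 j = p.2 j} := fun j =>
        isClosed_eq ((continuous_apply j).comp continuous_fst)
          ((continuous_apply j).comp continuous_snd)
      have h2 : IsClosed {p : (ℤ → S) × (ℤ → S) | g p.1 ≠ g p.2} :=
        isClosed_setOf_ne (hg.comp continuous_fst) (hg.comp continuous_snd)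
      refine IsClosed.and ?_ h2
      simp only [Set.ofPred_forall]
      exact isClosed_iInter fun j => isClosed_iInter fun _ => isClosed_iInter fun _ => h1 j)
  refine (hp 0).2 (congrArg g (funext fun j => (hp j.natAbs).1 j (by omega) (by omega)))

theorem exists_hasRadius_of_continuous [Finite S] [TopologicalSpace S] [DiscreteTopology S]
    (hf : Continuous f)
    (hs : ∀ (t : ℤ) (x : ℤ → S) (i : ℤ), f (fun j => x (j + t)) i = f x (i + t)) :
    ∃ r, HasRadius f r := by
  obtain ⟨r, hr⟩ := exists_radius_of_continuous (fun x => f x 0) ((continuous_apply 0).comp hf)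
  refine ⟨r, fun x y i hxy => ?_, hs⟩
  have h := hr (fun j => x (j + i)) (fun j => y (j + i))
    fun j h1 h2 => hxy _ (by omega) (by omega)
  simpa only [hs, zero_add] using h

/-! ### Stairs -/

/-- The stair of length `3m` of the configuration `x` at the coordinate `i`. -/
def stairAt (f : (ℤ → S) → (ℤ → S)) (m : ℕ) (i : ℤ) (x : ℤ → S) :
    (Fin (2 * m) → S) × (Fin (2 * m) → S) :=
  (fun k => x (i + m + k), fun k => f x (i + k))

theorem stairAt_eq_iff {i i' : ℤ} {x x' : ℤ → S} :
    stairAt f m i x = stairAt f m i' x' ↔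
      (∀ j : ℤ, m ≤ j → j < 3 * m → x (i + j) = x' (i' + j)) ∧
        ∀ j : ℤ, 0 ≤ j → j < 2 * m → f x (i + j) = f x' (i' + j) := by
  simp only [stairAt, Prod.mk.injEq, funext_iff]
  constructor
  · rintro ⟨h1, h2⟩
    refine ⟨fun j hj hj' => ?_, fun j hj hj' => ?_⟩
    · have := h1 ⟨(j - m).toNat, by omega⟩
      simp only at this
      rwa [show i + m + ((j - m).toNat : ℤ) = i + j by omega,
        show i' + m + ((j - m).toNat : ℤ) = i' + j by omega] at this
    · have := h2 ⟨j.toNat, by omega⟩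
      simp only at this
      rwa [show (j.toNat : ℤ) = j by omega] at this
  · rintro ⟨h1, h2⟩
    refine ⟨fun k => ?_, fun k => h2 _ (by omega) (by omega)⟩
    rw [add_assoc, add_assoc]
    exact h1 _ (by omega) (by omega)

theorem stairAt_mem (i : ℤ) (x : ℤ → S) : stairAt f m i x ∈ rightStairs f m :=
  ⟨i, fun j => x j, fun j => f x j, x, fun _ => rfl, fun _ => rfl, fun _ => rfl, fun _ => rfl⟩

theorem HasRadius.stairAt_shift (h : HasRadius f r) (t i : ℤ) (x : ℤ → S) :
    stairAt f m i (fun j => x (j + t)) = stairAt f m (i + t) x := by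
  rw [stairAt_eq_iff]
  refine ⟨fun j _ _ => ?_, fun j _ _ => ?_⟩
  · congr 1
    ring
  · rw [h.shift]
    congr 1
    ring

theorem HasRadius.exists_stairAt_eq (h : HasRadius f r) (i : ℤ) (s : rightStairs f m) :
    ∃ x, stairAt f m i x = s := by
  obtain ⟨⟨v, w⟩, i', y, z, x, hv, hy, hz, hw⟩ := s
  refine ⟨fun j => x (j + (i' - i)), ?_⟩
  rw [h.stairAt_shift]
  simp only [stairAt, add_sub_cancel, Prod.mk.injEq]
  exact ⟨funext hv, funext hw⟩

theorem HasRadius.rightStairs_eq_range (h : HasRadius f r) (i : ℤ) :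
    rightStairs f m = Set.range (stairAt f m i) := by
  refine Set.Subset.antisymm (fun s hs => h.exists_stairAt_eq i ⟨s, hs⟩) ?_
  rintro _ ⟨x, rfl⟩
  exact stairAt_mem i x

/-- Replacing the cells to the right of a stair changes neither the stair nor the image to its
left. -/
theorem HasRadius.exists_stairAt_right (h : HasRadius f r) (hm : r ≤ m) (i : ℤ) (x y : ℤ → S) :
    ∃ x', stairAt f m i x' = stairAt f m i x ∧ (∀ j, i + 3 * m ≤ j → x' j = y j) ∧
      ∀ j, j < i + 2 * m → f x' j = f x j := by
  have key : ∀ j, j < i + 2 * m →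
      f (fun j => if i + 3 * m ≤ j then y j else x j) j = f x j := fun j hj =>
    h.congr _ _ j fun k _ _ => if_neg (by omega)
  refine ⟨_, ?_, fun j hj => if_pos hj, key⟩
  rw [stairAt_eq_iff]
  exact ⟨fun j _ _ => if_neg (by omega), fun j _ _ => key _ (by omega)⟩

/-- Reading one further cell to the right of a stair determines the next stair. -/
theorem HasRadius.stairAt_succ (h : HasRadius f r) (hm : r < m) {i i' : ℤ} {x x' : ℤ → S}
    (hs : stairAt f m i x = stairAt f m i' x') (ha : x (i + 3 * m) = x' (i' + 3 * m)) :
    f x i = f x' i' ∧ stairAt f m (i + 1) x = stairAt f m (i' + 1) x' := by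
  rw [stairAt_eq_iff] at hs ⊢
  have hx : ∀ j : ℤ, m ≤ j → j < 3 * m + 1 → x (i + j) = x' (i' + j) := fun j h1 h2 => by
    rcases eq_or_ne j (3 * m) with rfl | hj
    · exact ha
    · exact hs.1 j h1 (by omega)
  refine ⟨by simpa using hs.2 0 le_rfl (by omega), fun j h1 h2 => ?_, fun j h1 h2 => ?_⟩
  · rw [add_assoc, add_assoc]
    exact hx _ (by omega) (by omega)
  · rw [add_assoc, add_assoc]
    rcases lt_or_ge (1 + j) (2 * m) with hj | hj
    · exact hs.2 _ (by omega) hj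
    · have e1 := h.shift (i + (1 + j)) x 0
      have e2 := h.shift (i' + (1 + j)) x' 0
      rw [zero_add] at e1 e2
      rw [← e1, ← e2]
      refine h.congr _ _ _ fun k hk hk' => ?_
      rw [add_left_comm k i, add_left_comm k i']
      exact hx _ (by omega) (by omega)

theorem HasRadius.exists_stairAt_step (h : HasRadius f r) (hm : r < m) (i : ℤ)
    (p : rightStairs f m × S) :
    ∃ x : ℤ → S, p = (⟨stairAt f m i x, stairAt_mem i x⟩, x (i + 3 * m)) := by
  obtain ⟨s, a⟩ := p
  obtain ⟨x, hx⟩ := h.exists_stairAt_eq i s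
  obtain ⟨x', h1, h2, -⟩ := h.exists_stairAt_right hm.le i x fun _ => a
  refine ⟨x', ?_⟩
  rw [Prod.mk.injEq]
  exact ⟨Subtype.ext (hx.symm.trans h1.symm), (h2 _ le_rfl).symm⟩

/-- The transition on stairs: from a stair at a coordinate `i` and the next cell on its right to
the image cell at `i` and the stair at `i + 1`. -/
noncomputable def stairStep [Nonempty S] (f : (ℤ → S) → (ℤ → S)) (m : ℕ) :
    rightStairs f m × S → S × rightStairs f m := fun p =>
  let x := Classical.epsilon fun x : ℤ → S => stairAt f m 0 x = p.1 ∧ x (3 * m) = p.2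
  (f x 0, ⟨stairAt f m 1 x, stairAt_mem 1 x⟩)

section Step

variable [Nonempty S]

theorem HasRadius.stairStep_eq (h : HasRadius f r) (hm : r < m) (i : ℤ) (x : ℤ → S) :
    stairStep f m (⟨stairAt f m i x, stairAt_mem i x⟩, x (i + 3 * m)) =
      (f x i, ⟨stairAt f m (i + 1) x, stairAt_mem (i + 1) x⟩) := by
  have hex : ∃ y : ℤ → S, stairAt f m 0 y = stairAt f m i x ∧ y (3 * m) = x (i + 3 * m) :=
    ⟨fun j => x (j + i), by rw [h.stairAt_shift, zero_add], by rw [add_comm]⟩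
  have hy := Classical.epsilon_spec hex
  have := h.stairAt_succ hm hy.1 (by rw [zero_add]; exact hy.2)
  simp only [stairStep, Prod.mk.injEq, Subtype.mk.injEq]
  exact this

/-- Right-asymptotic configurations with the same image share a stair far to the right. Injectivity
recovers the previous stair from the output cell and the current stair, so agreement propagates
leftwards forever. -/
theorem HasRadius.isLeftClosing_of_injective (h : HasRadius f r) (hm : r < m)
    (hinj : Function.Injective (stairStep f m)) : IsLeftClosing f := by
  rintro y y' ⟨i, hi⟩ hne heq
  have key : ∀ k : ℕ, stairAt f m (i - k) y = stairAt f m (i - k) y' := by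
    intro k
    induction k with
    | zero =>
      rw [stairAt_eq_iff]
      exact ⟨fun j _ _ => hi _ (by push_cast; omega), fun j _ _ => by rw [heq]⟩
    | succ k ih =>
      have e : i - ((k + 1 : ℕ) : ℤ) + 1 = i - k := by push_cast; ring
      have h1 := h.stairStep_eq hm (i - ((k + 1 : ℕ) : ℤ)) y
      have h2 := h.stairStep_eq hm (i - ((k + 1 : ℕ) : ℤ)) y'
      simp only [e, ih, heq] at h1
      simp only [e] at h2
      have h3 := hinj (h1.trans h2.symm)
      exact congrArg (fun p => (p.1 : (Fin (2 * m) → S) × (Fin (2 * m) → S))) h3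
  refine hne (funext fun j => ?_)
  rcases le_or_gt i j with hj | hj
  · exact hi j hj
  -- The stair at `j - m` is the one whose part taken from `y` begins at `j`.
  · have := (stairAt_eq_iff.1 (key (i + m - j).toNat)).1 m le_rfl (by omega)
    rwa [show i - ((i + m - j).toNat : ℤ) + m = j by omega] at this

end Step

theorem stairStep_bijective_of_injective [Finite S] [Nonempty S]
    (h : Function.Injective (stairStep f m)) : Function.Bijective (stairStep f m) :=
  h.bijective_of_nat_card_le (by rw [Nat.card_prod, Nat.card_prod, mul_comm])

theorem stairStep_bijective_of_surjective [Finite S] [Nonempty S]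
    (h : Function.Surjective (stairStep f m)) : Function.Bijective (stairStep f m) :=
  h.bijective_of_nat_card_le (by rw [Nat.card_prod, Nat.card_prod, mul_comm])

/-! ### Left-closing cellular automata -/

section LeftClosing

variable [Finite S] [TopologicalSpace S] [DiscreteTopology S]

/-- The finite form of left-closing, by compactness: a common point of the violating sets would be
two configurations agreeing on `[1, ∞)`, differing at `0`, with equal images. -/
theorem HasRadius.exists_closing_radius (h : HasRadius f r) (hf : IsLeftClosing f) :
    ∃ m₀ : ℕ, ∀ x y : ℤ → S, (∀ j, 1 ≤ j → j ≤ (m₀ : ℤ) → x j = y j) →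
      (∀ j, -(m₀ : ℤ) ≤ j → j ≤ m₀ → f x j = f y j) → x 0 = y 0 := by
  by_contra! hcon
  have hc := h.continuous
  obtain ⟨p, hp⟩ := exists_mem_of_antitone
    (fun r : ℕ => {p : (ℤ → S) × (ℤ → S) |
      (∀ j, 1 ≤ j → j ≤ (r : ℤ) → p.1 j = p.2 j) ∧
      (∀ j, -(r : ℤ) ≤ j → j ≤ r → f p.1 j = f p.2 j) ∧ p.1 0 ≠ p.2 0})
    (fun r p hp => ⟨fun j h1 h2 => hp.1 j h1 (by push_cast; omega),
      fun j h1 h2 => hp.2.1 j (by push_cast; omega) (by push_cast; omega), hp.2.2⟩)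
    (fun r => by
      obtain ⟨x, y, h⟩ := hcon r
      exact ⟨(x, y), h⟩)
    (fun r => by
      have h1 : ∀ j : ℤ, IsClosed {p : (ℤ → S) × (ℤ → S) | p.1 j = p.2 j} := fun j =>
        isClosed_eq ((continuous_apply j).comp continuous_fst)
          ((continuous_apply j).comp continuous_snd)
      have h2 : ∀ j : ℤ, IsClosed {p : (ℤ → S) × (ℤ → S) | f p.1 j = f p.2 j} := fun j =>
        isClosed_eq ((continuous_apply j).comp (hc.comp continuous_fst))
          ((continuous_apply j).comp (hc.comp continuous_snd))
      have h3 : IsClosed {p : (ℤ → S) × (ℤ → S) | p.1 0 ≠ p.2 0} :=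
        isClosed_setOf_ne ((continuous_apply 0).comp continuous_fst)
          ((continuous_apply 0).comp continuous_snd)
      refine IsClosed.and ?_ (IsClosed.and ?_ h3)
      · simp only [Set.ofPred_forall]
        exact isClosed_iInter fun j => isClosed_iInter fun _ => isClosed_iInter fun _ => h1 j
      · simp only [Set.ofPred_forall]
        exact isClosed_iInter fun j => isClosed_iInter fun _ => isClosed_iInter fun _ => h2 j)
  refine hf p.1 p.2 ⟨1, fun j hj => (hp j.natAbs).1 j hj (by omega)⟩
    (fun e => (hp 0).2.2 (by rw [e])) ?_
  exact funext fun j => (hp j.natAbs).2.1 j (by omega) (by omega)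

theorem HasRadius.eventually_stairStep_injective [Nonempty S] (h : HasRadius f r)
    (hf : IsLeftClosing f) :
    ∀ᶠ m : ℕ in atTop, r < m ∧ Function.Injective (stairStep f m) := by
  obtain ⟨m₀, hm₀⟩ := h.exists_closing_radius hf
  filter_upwards [eventually_gt_atTop r, eventually_ge_atTop m₀] with m hr hm
  refine ⟨hr, fun p p' hp => ?_⟩
  obtain ⟨x, rfl⟩ := h.exists_stairAt_step hr 0 p
  obtain ⟨x', rfl⟩ := h.exists_stairAt_step hr 0 p'
  rw [h.stairStep_eq hr, h.stairStep_eq hr, Prod.mk.injEq, Subtype.mk.injEq,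
    stairAt_eq_iff] at hp
  obtain ⟨h0, h1, h2⟩ := hp
  have h1' : ∀ j : ℤ, m + 1 ≤ j → j ≤ 3 * m → x j = x' j := fun j hj hj' => by
    have := h1 (j - 1) (by omega) (by omega)
    rwa [show (0 : ℤ) + 1 + (j - 1) = j by ring] at this
  have h2' : ∀ j : ℤ, 0 ≤ j → j ≤ 2 * m → f x j = f x' j := fun j hj hj' => by
    rcases eq_or_ne j 0 with rfl | hj0
    · exact h0
    · have := h2 (j - 1) (by omega) (by omega)
      rwa [show (0 : ℤ) + 1 + (j - 1) = j by ring] at this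
  -- The step forgets only the cell `x m`. The closing radius centred at `m` recovers it, since `m₀
  -- ≤ m` keeps the needed cells of `x` in `(m, 3m]` and those of `f x` in `[0, 2m]`.
  have h3 : x m = x' m := by
    have := hm₀ (fun j => x (j + m)) (fun j => x' (j + m))
      (fun j hj hj' => h1' _ (by omega) (by omega))
      (fun j hj hj' => by
        rw [h.shift, h.shift]
        exact h2' _ (by omega) (by omega))
    simpa using this
  rw [Prod.mk.injEq, Subtype.mk.injEq, stairAt_eq_iff]
  simp only [zero_add]
  refine ⟨⟨fun j hj hj' => ?_, fun j hj hj' => h2' j hj (by omega)⟩,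
    h1' _ (by omega) (by omega)⟩
  rcases eq_or_ne j m with rfl | hjm
  · exact h3
  · exact h1' _ (by omega) (by omega)

end LeftClosing

/-! ### Counting stairs -/

/-- Surjectivity of the step allows going back one coordinate while choosing the output cell freely;
iterating prescribes any finite stretch of the image to the left. -/
theorem HasRadius.exists_stairAt_left_finite [Nonempty S] (h : HasRadius f r) (hm : r < m)
    (hsurj : Function.Surjective (stairStep f m)) (z : ℤ → S) (k : ℕ) :
    ∀ (i : ℤ) (s : rightStairs f m),
      ∃ x, stairAt f m i x = s ∧ ∀ j, i - k ≤ j → j < i → f x j = z j := by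
  induction k with
  | zero =>
    intro i s
    obtain ⟨x, hx⟩ := h.exists_stairAt_eq i s
    exact ⟨x, hx, fun j _ _ => by push_cast at *; omega⟩
  | succ k ih =>
    intro i s
    obtain ⟨⟨s', a⟩, hs'⟩ := hsurj (z (i - 1), s)
    obtain ⟨x, hx, hz⟩ := ih (i - 1) s'
    obtain ⟨x', h1, h2, h3⟩ := h.exists_stairAt_right hm.le (i - 1) x fun _ => a
    have e := h.stairStep_eq hm (i - 1) x'
    have e1 : (⟨stairAt f m (i - 1) x', stairAt_mem (i - 1) x'⟩ : rightStairs f m) = s' :=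
      Subtype.ext (h1.trans hx)
    rw [e1, h2 _ le_rfl, hs', Prod.mk.injEq, Subtype.ext_iff] at e
    simp only [sub_add_cancel] at e
    refine ⟨x', e.2.symm, fun j hj hj' => ?_⟩
    rcases eq_or_ne j (i - 1) with rfl | hne
    · exact e.1.symm
    · rw [h3 j (by omega)]
      exact hz j (by push_cast at hj; omega) (by omega)

/-- Every stair extends to a configuration with a prescribed right tail and whose image has a
prescribed left tail. -/
theorem HasRadius.exists_stairAt_connecting [Finite S] [Nonempty S] (h : HasRadius f r)
    (hm : r < m) (hsurj : Function.Surjective (stairStep f m)) (i : ℤ) (s : rightStairs f m)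
    (y z : ℤ → S) :
    ∃ x, stairAt f m i x = s ∧ (∀ j, i + 3 * m ≤ j → x j = y j) ∧ ∀ j, j < i → f x j = z j := by
  let : TopologicalSpace S := ⊥
  have : DiscreteTopology S := ⟨rfl⟩
  have hc := h.continuous
  have hcoord : ∀ j, Continuous fun x => f x j := fun j => (continuous_apply j).comp hc
  obtain ⟨x, hx⟩ := exists_mem_of_antitone
    (fun k : ℕ => {x : ℤ → S | stairAt f m i x = s ∧ ∀ j, i - k ≤ j → j < i → f x j = z j})
    (fun k x hx => ⟨hx.1, fun j h1 h2 => hx.2 j (by push_cast; omega) h2⟩)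
    (fun k => h.exists_stairAt_left_finite hm hsurj z k i s)
    (fun k => by
      refine IsClosed.and ?_ ?_
      · refine isClosed_eq (Continuous.prodMk ?_ ?_) continuous_const
        · exact continuous_pi fun k => continuous_apply _
        · exact continuous_pi fun k => hcoord _
      · simp only [Set.ofPred_forall]
        exact isClosed_iInter fun j => isClosed_iInter fun _ => isClosed_iInter fun _ =>
          isClosed_eq (hcoord j) continuous_const)
  obtain ⟨x', h1, h2, h3⟩ := h.exists_stairAt_right hm.le i x y
  refine ⟨x', h1.trans (hx 0).1, h2, fun j hj => ?_⟩
  rw [h3 j (by omega)]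
  exact (hx (i - j).toNat).2 j (by omega) hj

theorem card_range_eq_of_ker_eq {X α β : Type*} (a : X → α) (b : X → β)
    (hab : ∀ x y, a x = a y ↔ b x = b y) :
    Nat.card (Set.range a) = Nat.card (Set.range b) := by
  have : Setoid.ker a = Setoid.ker b := Setoid.ext hab
  exact Nat.card_congr ((Setoid.quotientKerEquivRange a).symm.trans
    ((Quotient.congrRight fun x y => hab x y).trans (Setoid.quotientKerEquivRange b)))

/-- The larger stair at `0` amounts to the smaller one at `1` with three additional cells: `f x 0`,
`x (3m + 1)` and `x (3m + 2)`. These are free by `exists_stairAt_connecting`, and the remaining new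
cell `f x (2m + 1)` is computed from the known part of `x`. -/
theorem HasRadius.card_rightStairs_succ [Finite S] [Nonempty S] (h : HasRadius f r)
    (hm : r < m) (hsurj : Function.Surjective (stairStep f m)) :
    (rightStairs f (m + 1)).ncard = (rightStairs f m).ncard * Nat.card S ^ 3 := by
  let b : (ℤ → S) → rightStairs f m × S × S × S := fun x =>
    (⟨stairAt f m 1 x, stairAt_mem 1 x⟩, f x 0, x (3 * m + 1), x (3 * m + 2))
  have hb : Set.range b = Set.univ := by
    refine Set.eq_univ_of_forall fun ⟨s, c, a, a'⟩ => ?_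
    obtain ⟨x, h1, h2, h3⟩ := h.exists_stairAt_connecting hm hsurj 1 s
      (fun j => if j = 3 * m + 1 then a else a') (fun _ => c)
    refine ⟨x, ?_⟩
    simp only [b, Prod.mk.injEq, Subtype.ext_iff]
    exact ⟨h1, h3 0 (by omega), by rw [h2 _ (by omega), if_pos rfl],
      by rw [h2 _ (by omega), if_neg (by omega)]⟩
  have hker : ∀ x y, stairAt f (m + 1) 0 x = stairAt f (m + 1) 0 y ↔ b x = b y := by
    intro x y
    simp only [b, Prod.mk.injEq, Subtype.mk.injEq, stairAt_eq_iff, zero_add]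
    push_cast
    constructor
    · rintro ⟨h1, h2⟩
      exact ⟨⟨fun j _ _ => h1 _ (by omega) (by omega), fun j _ _ => h2 _ (by omega) (by omega)⟩,
        h2 _ (by omega) (by omega), h1 _ (by omega) (by omega), h1 _ (by omega) (by omega)⟩
    · rintro ⟨⟨h1, h2⟩, h3, h4, h5⟩
      have hx : ∀ j : ℤ, m + 1 ≤ j → j < 3 * (m + 1) → x j = y j := fun j hj hj' => by
        rcases lt_or_ge j (3 * m + 1) with hlt | hge
        · have := h1 (j - 1) (by omega) (by omega)
          rwa [add_sub_cancel] at this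
        · obtain rfl | rfl : j = 3 * m + 1 ∨ j = 3 * m + 2 := by omega
          · exact h4
          · exact h5
      refine ⟨hx, fun j hj hj' => ?_⟩
      rcases eq_or_ne j 0 with rfl | hj0
      · exact h3
      · rcases lt_or_ge j (2 * m + 1) with hlt | hge
        · have := h2 (j - 1) (by omega) (by omega)
          rwa [add_sub_cancel] at this
        · exact h.congr _ _ _ fun k _ _ => hx k (by omega) (by omega)
  have key := card_range_eq_of_ker_eq _ b hker
  rw [← h.rightStairs_eq_range, hb, Nat.card_univ, Nat.card_prod, Nat.card_prod,
    Nat.card_prod, Nat.card_coe_set_eq, Nat.card_coe_set_eq] at key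
  rw [key]
  ring

theorem ncard_rightStairs_pos [Finite S] [Nonempty S] : 0 < (rightStairs f m).ncard :=
  (Set.ncard_pos (Set.toFinite _)).2 ⟨_, stairAt_mem 0 fun _ => Classical.arbitrary S⟩

theorem stairRatio_pos [Finite S] [Nonempty S] : 0 < stairRatio f m := by
  have h1 : (0 : ℚ) < (rightStairs f m).ncard := by exact_mod_cast ncard_rightStairs_pos
  have h2 : (0 : ℚ) < Nat.card S := by exact_mod_cast Nat.card_pos
  exact div_pos h1 (pow_pos h2 _)

/-- For a left-closing cellular automaton, the ratios are eventually equal to their limit. -/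
theorem HasRadius.eventually_stairRatio_eq [Finite S] [Nonempty S] (h : HasRadius f r)
    (hf : IsLeftClosing f) : ∀ᶠ m : ℕ in atTop, stairRatio f m = stairLimit f := by
  let : TopologicalSpace S := ⊥
  have : DiscreteTopology S := ⟨rfl⟩
  obtain ⟨m₀, hm₀⟩ := eventually_atTop.1 (h.eventually_stairStep_injective hf)
  have hS : (Nat.card S : ℚ) ≠ 0 := by exact_mod_cast Nat.card_pos.ne'
  have hconst : ∀ m, m₀ ≤ m → stairRatio f m = stairRatio f m₀ := by
    intro m hm
    induction m, hm using Nat.le_induction with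
    | base => rfl
    | succ m hm ih =>
      obtain ⟨h1, h2⟩ := hm₀ m hm
      rw [← ih, stairRatio, stairRatio,
        h.card_rightStairs_succ h1 (stairStep_bijective_of_injective h2).2, mul_add, mul_one,
        pow_add]
      push_cast
      exact mul_div_mul_right _ _ (pow_ne_zero 3 hS)
  have hlim : Tendsto (stairRatio f) atTop (𝓝 (stairRatio f m₀)) :=
    tendsto_const_nhds.congr' (eventually_atTop.2 ⟨m₀, fun m hm => (hconst m hm).symm⟩)
  rw [stairLimit, hlim.limUnder_eq]
  exact eventually_atTop.2 ⟨m₀, hconst⟩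

/-! ### Sweeps of a block rule and their limits -/

section Sweep

variable {χ : (Fin n → S) → (Fin n → S)}

theorem applyAt_of_not_mem {i j : ℤ} (x : ℤ → S) (h : ¬(i ≤ j ∧ j < i + n)) :
    applyAt χ i x j = x j := dif_neg h

theorem applyAt_add (i : ℤ) (x : ℤ → S) (k : Fin n) :
    applyAt χ i x (i + k) = χ (fun k => x (i + k)) k := by
  rw [applyAt, dif_pos ⟨by omega, by omega⟩]
  congr 1
  ext
  simp

theorem applyAt_eq {i : ℤ} {x x' : ℤ → S} (h : ∀ j, ¬(i ≤ j ∧ j < i + n) → x j = x' j)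
    (hχ : χ (fun k => x (i + k)) = fun k : Fin n => x' (i + k)) : applyAt χ i x = x' := by
  funext j
  by_cases hj : i ≤ j ∧ j < i + n
  · obtain ⟨k, rfl⟩ : ∃ k : Fin n, j = i + k := ⟨⟨(j - i).toNat, by omega⟩, by simp; omega⟩
    rw [applyAt_add, hχ]
  · rw [applyAt_of_not_mem _ hj, h j hj]

theorem applyAt_symm_applyAt (χ : Equiv.Perm (Fin n → S)) (i : ℤ) (x : ℤ → S) :
    applyAt χ.symm i (applyAt χ i x) = x :=
  applyAt_eq (fun _ h => applyAt_of_not_mem x h)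
    (by simp only [applyAt_add, Equiv.symm_apply_apply])

theorem applyAt_congr {a b i : ℤ} {x x' : ℤ → S} (hx : ∀ j, a ≤ j → j < b → x j = x' j)
    (ha : a ≤ i) (hb : i + n ≤ b) :
    ∀ j, a ≤ j → j < b → applyAt χ i x j = applyAt χ i x' j := by
  intro j hj hj'
  by_cases h : i ≤ j ∧ j < i + n
  · rw [applyAt, applyAt, dif_pos h, dif_pos h]
    congr 1
    funext k
    exact hx _ (by omega) (by omega)
  · rw [applyAt_of_not_mem _ h, applyAt_of_not_mem _ h, hx j hj hj']

theorem applyAt_shift (i t : ℤ) (x : ℤ → S) :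
    applyAt χ i (fun j => x (j + t)) = fun j => applyAt χ (i + t) x (j + t) := by
  funext j
  by_cases h : i ≤ j ∧ j < i + n
  · rw [applyAt, applyAt, dif_pos h, dif_pos (by omega)]
    simp only [add_right_comm i t, add_sub_add_right_eq_sub]
  · rw [applyAt_of_not_mem _ h, applyAt_of_not_mem _ (by omega)]

theorem continuous_applyAt [Finite S] [TopologicalSpace S] [DiscreteTopology S] (i : ℤ) :
    Continuous (applyAt χ i) := by
  refine continuous_pi fun j => ?_
  by_cases h : i ≤ j ∧ j < i + n
  · simp only [applyAt, dif_pos h]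
    exact (continuous_apply _).comp ((continuous_of_discreteTopology (f := χ)).comp
      (continuous_pi fun k => continuous_apply _))
  · simp only [applyAt_of_not_mem _ h]
    exact continuous_apply j

/-- The last of `k` applications sits at `i + k - 1` and reads up to `i + k - 1 + n`, whence the `b
+ 1`; with `k = 0` nothing is read. -/
theorem sweepRight_congr {a b i : ℤ} {x x' : ℤ → S} (hx : ∀ j, a ≤ j → j < b → x j = x' j)
    (ha : a ≤ i) (k : ℕ) (hb : k = 0 ∨ i + k + n ≤ b + 1) :
    ∀ j, a ≤ j → j < b → sweepRight χ i k x j = sweepRight χ i k x' j := by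
  induction k with
  | zero => exact hx
  | succ k ih => exact applyAt_congr (ih (by omega)) (by omega) (by omega)

theorem sweepRight_add_of_lt {i j : ℤ} (x : ℤ → S) {k : ℕ} (h : j < i + k) (l : ℕ) :
    sweepRight χ i (k + l) x j = sweepRight χ i k x j := by
  induction l with
  | zero => rfl
  | succ l ih =>
    rw [← ih, ← add_assoc]
    exact applyAt_of_not_mem _ (by push_cast; omega)

theorem sweepLeft_add_of_le {i j : ℤ} (x : ℤ → S) {k : ℕ} (h : i - k + n ≤ j + 1) (l : ℕ) :
    sweepLeft χ i (k + l) x j = sweepLeft χ i k x j := by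
  induction l with
  | zero => rfl
  | succ l ih =>
    rw [← ih, ← add_assoc]
    exact applyAt_of_not_mem _ (by push_cast; omega)

theorem sweepRight_succ' (i : ℤ) (k : ℕ) (x : ℤ → S) :
    sweepRight χ i (k + 1) x = sweepRight χ (i + 1) k (applyAt χ i x) := by
  induction k with
  | zero => simp [sweepRight]
  | succ k ih =>
    rw [sweepRight, ih, sweepRight]
    congr 1
    push_cast
    ring

theorem sweepLeft_succ' (i : ℤ) (k : ℕ) (x : ℤ → S) :
    sweepLeft χ (i + 1) (k + 1) x = sweepLeft χ i k (applyAt χ i x) := by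
  induction k with
  | zero => simp [sweepLeft]
  | succ k ih =>
    rw [sweepLeft, ih, sweepLeft]
    congr 1
    push_cast
    ring

theorem sweepRight_shift (i t : ℤ) (k : ℕ) (x : ℤ → S) :
    sweepRight χ i k (fun j => x (j + t)) = fun j => sweepRight χ (i + t) k x (j + t) := by
  induction k with
  | zero => rfl
  | succ k ih =>
    rw [sweepRight, ih, applyAt_shift, sweepRight, add_right_comm]

theorem sweepLeft_shift (i t : ℤ) (k : ℕ) (x : ℤ → S) :
    sweepLeft χ i k (fun j => x (j + t)) = fun j => sweepLeft χ (i + t) k x (j + t) := by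
  induction k with
  | zero => rfl
  | succ k ih =>
    rw [sweepLeft, ih, applyAt_shift, sweepLeft, sub_add_eq_add_sub]

/-- The limit of the left-to-right sweeps. -/
def rightLim (χ : (Fin n → S) → (Fin n → S)) (i : ℤ) (x : ℤ → S) : ℤ → S :=
  fun j => sweepRight χ i (j - i + 1).toNat x j

/-- The limit of the right-to-left sweeps. -/
def leftLim (χ : (Fin n → S) → (Fin n → S)) (i : ℤ) (x : ℤ → S) : ℤ → S :=
  fun j => sweepLeft χ i (i + n - j).toNat x j

theorem rightLim_apply {i j : ℤ} (x : ℤ → S) {k : ℕ} (h : j < i + k) :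
    rightLim χ i x j = sweepRight χ i k x j := by
  obtain ⟨l, rfl⟩ := Nat.exists_eq_add_of_le (show (j - i + 1).toNat ≤ k by omega)
  exact (sweepRight_add_of_lt x (by omega) l).symm

theorem leftLim_apply {i j : ℤ} (x : ℤ → S) {k : ℕ} (h : i - k + n ≤ j) :
    leftLim χ i x j = sweepLeft χ i k x j := by
  obtain ⟨l, rfl⟩ := Nat.exists_eq_add_of_le (show (i + n - j).toNat ≤ k by omega)
  exact (sweepLeft_add_of_le x (by omega) l).symm

theorem leftLim_of_le {i j : ℤ} (x : ℤ → S) (h : i + n ≤ j) : leftLim χ i x j = x j :=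
  leftLim_apply x (k := 0) (by simpa using h)

theorem rightLim_applyAt (i : ℤ) (x : ℤ → S) :
    rightLim χ (i + 1) (applyAt χ i x) = rightLim χ i x := by
  funext j
  rw [rightLim_apply (k := (j - i).toNat) _ (by omega), ← sweepRight_succ']
  exact (rightLim_apply _ (by push_cast; omega)).symm

/-- An application at `i` is the first move of the leftward sweep started at `i + 1`. -/
theorem leftLim_applyAt (i : ℤ) (x : ℤ → S) :
    leftLim χ i (applyAt χ i x) = leftLim χ (i + 1) x := by
  funext j
  rw [leftLim_apply (k := (i + n - j).toNat) _ (by omega), ← sweepLeft_succ']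
  exact (leftLim_apply _ (by push_cast; omega)).symm

theorem rightLim_shift (i t : ℤ) (x : ℤ → S) :
    rightLim χ i (fun j => x (j + t)) = fun j => rightLim χ (i + t) x (j + t) := by
  funext j
  rw [rightLim, sweepRight_shift, rightLim, add_sub_add_right_eq_sub]

theorem leftLim_shift (i t : ℤ) (x : ℤ → S) :
    leftLim χ i (fun j => x (j + t)) = fun j => leftLim χ (i + t) x (j + t) := by
  funext j
  rw [leftLim, sweepLeft_shift, leftLim, add_right_comm, add_sub_add_right_eq_sub]

theorem tendsto_sweepRight [TopologicalSpace S] (i : ℤ) (x : ℤ → S) :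
    Tendsto (fun k : ℕ => sweepRight χ i k x) atTop (𝓝 (rightLim χ i x)) :=
  tendsto_pi_nhds.2 fun j => tendsto_const_nhds.congr' <|
    (eventually_ge_atTop (j - i + 1).toNat).mono fun _ _ => rightLim_apply x (by omega)

theorem tendsto_sweepLeft [TopologicalSpace S] (i : ℤ) (x : ℤ → S) :
    Tendsto (fun k : ℕ => sweepLeft χ i k x) atTop (𝓝 (leftLim χ i x)) :=
  tendsto_pi_nhds.2 fun j => tendsto_const_nhds.congr' <|
    (eventually_ge_atTop (i + n - j).toNat).mono fun _ _ => leftLim_apply x (by omega)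

section Topology

variable [TopologicalSpace S] [DiscreteTopology S]

theorem sliderRel_iff {χ : Equiv.Perm (Fin n → S)} {y z : ℤ → S} :
    SliderRel χ y z ↔ ∃ x i, leftLim χ.symm i x = y ∧ rightLim χ i x = z := by
  refine exists₂_congr fun x i => and_congr ⟨fun h => ?_, ?_⟩ ⟨fun h => ?_, ?_⟩
  · exact tendsto_nhds_unique (tendsto_sweepLeft i x) h
  · rintro rfl
    exact tendsto_sweepLeft i x
  · exact tendsto_nhds_unique (tendsto_sweepRight i x) h
  · rintro rfl
    exact tendsto_sweepRight i x

theorem continuous_rightLim [Finite S] (i : ℤ) : Continuous (rightLim χ i) := by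
  refine continuous_pi fun j => (continuous_apply j).comp ?_
  generalize (j - i + 1).toNat = k
  induction k with
  | zero => exact continuous_id
  | succ k ih => exact (continuous_applyAt _).comp ih

theorem continuous_leftLim [Finite S] (i : ℤ) : Continuous (leftLim χ i) := by
  refine continuous_pi fun j => (continuous_apply j).comp ?_
  generalize (i + n - j).toNat = k
  induction k with
  | zero => exact continuous_id
  | succ k ih => exact (continuous_applyAt _).comp ih

end Topology

end Sweep

/-! ### Sliders are left-closing cellular automata -/

/-- `f` maps the limit of the leftward sweeps of `χ⁻¹` to the limit of the rightward sweeps of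
`χ`, and every configuration is such a limit. -/
structure SlidesAlong (f : (ℤ → S) → (ℤ → S)) (χ : Equiv.Perm (Fin n → S)) : Prop where
  map : ∀ i x, f (leftLim χ.symm i x) = rightLim χ i x
  surj : ∀ i, Function.Surjective (leftLim χ.symm i)

section Slider

variable {χ : Equiv.Perm (Fin n → S)}

theorem leftLim_symm_applyAt (i : ℤ) (x : ℤ → S) :
    leftLim χ.symm (i + 1) (applyAt χ i x) = leftLim χ.symm i x := by
  rw [← leftLim_applyAt, applyAt_symm_applyAt]

/-- The starting coordinate can be moved by one by applying `χ` or its inverse there without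
changing the leftward limit, so a representation found at one coordinate yields one at every
coordinate. -/
theorem slidesAlong_iff [TopologicalSpace S] [DiscreteTopology S] :
    (∀ y z, SliderRel χ y z ↔ f y = z) ↔ SlidesAlong f χ := by
  simp only [sliderRel_iff]
  constructor
  · intro h
    refine ⟨fun i x => (h _ _).1 ⟨x, i, rfl, rfl⟩, fun i y => ?_⟩
    obtain ⟨x, i₀, hx, -⟩ := (h y (f y)).2 rfl
    induction i using Int.inductionOn' (b := i₀) with
    | zero => exact ⟨x, hx⟩
    | succ k _ ih =>
      obtain ⟨x, hx⟩ := ih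
      exact ⟨applyAt χ k x, by rw [leftLim_symm_applyAt, hx]⟩
    | pred k _ ih =>
      obtain ⟨x, hx⟩ := ih
      exact ⟨applyAt χ.symm (k - 1) x, by rw [leftLim_applyAt, sub_add_cancel, hx]⟩
  · intro h y z
    constructor
    · rintro ⟨x, i, rfl, rfl⟩
      exact h.map i x
    · rintro rfl
      obtain ⟨x, rfl⟩ := h.surj 0 y
      exact ⟨x, 0, rfl, (h.map 0 x).symm⟩

/-- The leftward limit at `0` is a continuous surjection from a compact to a Hausdorff space, hence
a quotient map, and `f` composed with it is the continuous rightward limit. Shift-invariance holds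
because both limits commute with shifts. -/
theorem SlidesAlong.exists_hasRadius [Finite S] (h : SlidesAlong f χ) :
    ∃ r, HasRadius f r := by
  let _ : TopologicalSpace S := ⊥
  have : DiscreteTopology S := ⟨rfl⟩
  refine exists_hasRadius_of_continuous ?_ fun t y i => ?_
  · have hc : Continuous (leftLim χ.symm 0) := continuous_leftLim 0
    refine (hc.isClosedMap.isQuotientMap hc (h.surj 0)).continuous_iff.2 ?_
    rw [show f ∘ leftLim χ.symm 0 = rightLim χ 0 from funext (h.map 0)]
    exact continuous_rightLim 0
  · obtain ⟨x, rfl⟩ := h.surj (0 + t) y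
    rw [← leftLim_shift, h.map, h.map, rightLim_shift]

/-- The leftward sweep leaves cells from `i + n` on untouched, and the rightward limit on `[i, i +
2m)` is settled after `2m` applications, which read no further than `i + 2m - 1 + n`. As `n ≤ m`,
the block `[i, i + 3m)` decides everything. -/
theorem SlidesAlong.stairAt_congr (h : SlidesAlong f χ) (hn : n ≤ m) {i : ℤ} {x x' : ℤ → S}
    (hx : ∀ j, i ≤ j → j < i + 3 * m → x j = x' j) :
    stairAt f m i (leftLim χ.symm i x) = stairAt f m i (leftLim χ.symm i x') := by
  rw [stairAt_eq_iff, h.map, h.map]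
  refine ⟨fun j _ _ => ?_, fun j _ _ => ?_⟩
  · rw [leftLim_of_le _ (by omega), leftLim_of_le _ (by omega)]
    exact hx _ (by omega) (by omega)
  · rw [rightLim_apply (k := 2 * m) _ (by push_cast; omega),
      rightLim_apply (k := 2 * m) _ (by push_cast; omega)]
    exact sweepRight_congr hx le_rfl _ (by push_cast; omega) _ (by omega) (by omega)

theorem SlidesAlong.stairStep_surjective [Nonempty S] (h : SlidesAlong f χ)
    (hr : HasRadius f r) (hn : n ≤ m) (hm : r < m) : Function.Surjective (stairStep f m) := by
  rintro ⟨b, s⟩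
  obtain ⟨y, hy⟩ := hr.exists_stairAt_eq (0 + 1) s
  obtain ⟨x, rfl⟩ := h.surj (0 + 1) y
  -- With the sweeps started at `1`, the cell at `0` is already final output, and the stair at `1`
  -- does not see it; so it can be overwritten by `b`.
  let x' : ℤ → S := fun j => if j = 0 then b else x j
  have hx : leftLim χ.symm 0 (applyAt χ.symm 0 x') = leftLim χ.symm (0 + 1) x' :=
    leftLim_applyAt 0 x'
  refine ⟨_, (hr.stairStep_eq hm 0 (leftLim χ.symm 0 (applyAt χ.symm 0 x'))).trans ?_⟩
  rw [Prod.mk.injEq, Subtype.ext_iff, hx]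
  constructor
  · rw [h.map, rightLim_apply (k := 0) _ (by simp)]
    have : x' 0 = b := if_pos rfl
    exact this
  · rw [← hy]
    exact h.stairAt_congr hn fun j _ _ => if_neg (by omega)

/-! ### Blocks are equidistributed over stairs -/

/-- The stair encoded by a block of length `3m`. -/
noncomputable def blockStair [Nonempty S] (f : (ℤ → S) → (ℤ → S)) (χ : Equiv.Perm (Fin n → S))
    (m : ℕ) (u : Fin (3 * m) → S) : rightStairs f m :=
  ⟨stairAt f m 0 (leftLim χ.symm 0 fun j =>
    if h : 0 ≤ j ∧ j < 3 * m then u ⟨j.toNat, by omega⟩ else Classical.arbitrary S),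
    stairAt_mem _ _⟩

theorem SlidesAlong.blockStair_eq [Nonempty S] (h : SlidesAlong f χ) (hr : HasRadius f r)
    (hn : n ≤ m) (i : ℤ) (x : ℤ → S) :
    blockStair f χ m (fun k => x (i + k)) =
      ⟨stairAt f m i (leftLim χ.symm i x), stairAt_mem _ _⟩ := by
  rw [blockStair, Subtype.mk.injEq, ← zero_add i, ← hr.stairAt_shift, ← leftLim_shift]
  refine h.stairAt_congr hn fun j hj hj' => ?_
  rw [dif_pos ⟨hj, by omega⟩]
  congr 1
  simp only [zero_add, Int.toNat_of_nonneg hj]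
  ring

/-- A bijection covering an injection along projections with fibres preserves the sizes of the
fibres. -/
theorem card_fiber_eq_of_step {U P : Type*} [Finite U] {A : Type*} [Finite A] (G : U → P)
    (Φ : P × A → A × P) (hΦ : Function.Injective Φ) (T : U × A → A × U)
    (hT : Function.Injective T)
    (hcomm : ∀ p, Φ (G p.1, p.2) = ((T p).1, G (T p).2)) {s s' : P} {a b : A}
    (hs : Φ (s, a) = (b, s')) : Nat.card {u // G u = s} = Nat.card {u // G u = s'} := by
  have hTs : Function.Surjective T :=
    (hT.bijective_of_nat_card_le (by rw [Nat.card_prod, Nat.card_prod, mul_comm])).2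
  have hstep : ∀ u, G u = s → (T (u, a)).1 = b ∧ G (T (u, a)).2 = s' := by
    rintro u rfl
    exact Prod.mk.inj ((hcomm (u, a)).symm.trans hs)
  refine Nat.card_congr (Equiv.ofBijective
    (fun u => (⟨(T (u.1, a)).2, (hstep u.1 u.2).2⟩ : {u // G u = s'})) ⟨?_, ?_⟩)
  · rintro ⟨u, hu⟩ ⟨v, hv⟩ huv
    have h1 : T (u, a) = T (v, a) :=
      Prod.ext ((hstep u hu).1.trans (hstep v hv).1.symm) (Subtype.mk.inj huv)
    exact Subtype.ext (Prod.mk.inj (hT h1)).1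
  · rintro ⟨u', hu'⟩
    obtain ⟨⟨u, c⟩, hu⟩ := hTs (b, u')
    have h1 := hcomm (u, c)
    simp only [hu, hu'] at h1
    obtain ⟨h2, rfl⟩ := Prod.mk.inj (hΦ (h1.trans hs.symm))
    exact ⟨⟨u, h2⟩, Subtype.ext (by simp only [hu])⟩

/-- Applying `χ` to a block followed by a cell and splitting off the first cell is an injection
covering `stairStep`: moving the starting coordinate past an application of `χ` keeps the same
leftward limit. -/
theorem SlidesAlong.card_fiber_succ [Finite S] [Nonempty S] (h : SlidesAlong f χ)
    (hr : HasRadius f r) (hn : n ≤ m) (hm : r < m) (i : ℤ) (x : ℤ → S) :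
    Nat.card {u // blockStair f χ m u = ⟨stairAt f m i x, stairAt_mem _ _⟩} =
      Nat.card {u // blockStair f χ m u = ⟨stairAt f m (i + 1) x, stairAt_mem _ _⟩} := by
  have hΦ := stairStep_bijective_of_surjective (h.stairStep_surjective hr hn hm)
  -- Only the value at `3 * m` outside the block matters; the padding elsewhere is arbitrary.
  let X : (Fin (3 * m) → S) × S → ℤ → S := fun p j =>
    if h : 0 ≤ j ∧ j < 3 * m then p.1 ⟨j.toNat, by omega⟩ else p.2
  have hX1 : ∀ p, (fun k : Fin (3 * m) => X p (0 + (k : ℕ))) = p.1 := fun p => by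
    funext k
    exact (dif_pos (by omega)).trans (congrArg p.1 (Fin.ext (by simp)))
  have hX2 : ∀ p, X p (0 + 3 * m) = p.2 := fun p => dif_neg (by omega)
  refine card_fiber_eq_of_step (blockStair f χ m) (stairStep f m) hΦ.1
    (fun p => (applyAt χ 0 (X p) 0, fun k => applyAt χ 0 (X p) (0 + 1 + (k : ℕ)))) ?_ ?_
    (hr.stairStep_eq hm i x)
  · intro p q hpq
    obtain ⟨h0, h1⟩ := Prod.mk.inj hpq
    have h2 : ∀ j : ℤ, 0 ≤ j → j < 3 * m + 1 →
        applyAt χ 0 (X p) j = applyAt χ 0 (X q) j := fun j hj hj' => by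
      rcases eq_or_ne j 0 with rfl | hj0
      · exact h0
      · have := congrFun h1 ⟨(j - 1).toNat, by omega⟩
        simp only at this
        rwa [show (0 : ℤ) + 1 + ((j - 1).toNat : ℤ) = j by omega] at this
    have h3 := applyAt_congr (χ := χ.symm) h2 le_rfl (by omega)
    simp only [applyAt_symm_applyAt] at h3
    refine Prod.ext ?_ ?_
    · rw [← hX1 p, ← hX1 q]
      exact funext fun k => h3 _ (by omega) (by omega)
    · rw [← hX2 p, ← hX2 q]
      exact h3 _ (by omega) (by omega)
  · intro p
    have e1 := h.blockStair_eq hr hn 0 (X p)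
    rw [hX1] at e1
    have e2 := h.blockStair_eq hr hn (0 + 1) (applyAt χ 0 (X p))
    rw [e2, e1]
    have e3 := hr.stairStep_eq hm 0 (leftLim χ.symm 0 (X p))
    rw [leftLim_of_le _ (by omega), hX2] at e3
    rw [e3]
    simp only [leftLim_symm_applyAt]
    rw [h.map, ← rightLim_applyAt, rightLim_apply (k := 0) _ (by simp)]
    rfl

/-- Fibre size is constant along the stairs of one configuration, and two stairs can be continued to
the right by the same tail until they merge. -/
theorem SlidesAlong.card_fiber_eq [Finite S] [Nonempty S] (h : SlidesAlong f χ)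
    (hr : HasRadius f r) (hn : n ≤ m) (hm : r < m) (s s' : rightStairs f m) :
    Nat.card {u // blockStair f χ m u = s} = Nat.card {u // blockStair f χ m u = s'} := by
  have hstep : ∀ (x : ℤ → S) (k : ℕ),
      Nat.card {u // blockStair f χ m u = ⟨stairAt f m 0 x, stairAt_mem _ _⟩} =
        Nat.card {u // blockStair f χ m u = ⟨stairAt f m k x, stairAt_mem _ _⟩} := by
    intro x k
    induction k with
    | zero => rfl
    | succ k ih =>
      rw [ih, h.card_fiber_succ hr hn hm k x]
      rfl
  obtain ⟨x, hx⟩ := hr.exists_stairAt_eq 0 s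
  obtain ⟨x', hx'⟩ := hr.exists_stairAt_eq 0 s'
  obtain ⟨y, hy, hyx, -⟩ := hr.exists_stairAt_right hm.le 0 x' x
  -- The tails agree from `3m` on, so the images agree from `3m + r` on.
  have hsync : stairAt f m ((3 * m + r : ℕ) : ℤ) x = stairAt f m ((3 * m + r : ℕ) : ℤ) y := by
    rw [stairAt_eq_iff]
    push_cast
    exact ⟨fun j _ _ => (hyx _ (by omega)).symm, fun j _ _ =>
      hr.congr _ _ _ fun l _ _ => (hyx l (by omega)).symm⟩
  have e1 := hstep x (3 * m + r)
  have e2 := hstep y (3 * m + r)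
  simp only [hsync] at e1
  simp only [hx] at e1
  simp only [hy, hx'] at e2
  exact e1.trans e2.symm

theorem SlidesAlong.exists_card_eq [Finite S] [Nonempty S] (h : SlidesAlong f χ)
    (hr : HasRadius f r) (hn : n ≤ m) (hm : r < m) :
    ∃ N : ℕ, N * (rightStairs f m).ncard = Nat.card S ^ (3 * m) := by
  refine ⟨Nat.card {u // blockStair f χ m u =
    ⟨stairAt f m 0 fun _ => Classical.arbitrary S, stairAt_mem _ _⟩}, ?_⟩
  have := Fintype.ofFinite (rightStairs f m)
  have e := Nat.card_congr (Equiv.sigmaFiberEquiv (blockStair f χ m))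
  rw [Nat.card_sigma, Finset.sum_congr rfl fun s _ => h.card_fiber_eq hr hn hm s _,
    Finset.sum_const, Finset.card_univ, ← Nat.card_eq_fintype_card, Nat.card_coe_set_eq,
    Nat.card_fun, Nat.card_fin, smul_eq_mul, mul_comm] at e
  exact e

end Slider

/-! ### Sliders from an encoding of stairs by blocks -/

section Encoding

variable {C : Type*}

/-- The configuration showing `f x` to the left of `i`, a code for the stair of `x` at `i` on
`[i, i + 3m)`, and `x` to the right. -/
noncomputable def encodeAt (code : (Fin (3 * m) → S) ≃ rightStairs f m × C) (c : C) (i : ℤ)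
    (x : ℤ → S) : ℤ → S := fun j =>
  if h : i ≤ j ∧ j < i + 3 * m then
    code.symm (⟨stairAt f m i x, stairAt_mem i x⟩, c) ⟨(j - i).toNat, by omega⟩
  else if j < i then f x j else x j

variable {code : (Fin (3 * m) → S) ≃ rightStairs f m × C} {c : C}

theorem encodeAt_of_lt {i j : ℤ} (x : ℤ → S) (h : j < i) : encodeAt code c i x j = f x j := by
  rw [encodeAt, dif_neg (by omega), if_pos h]

theorem encodeAt_of_le {i j : ℤ} (x : ℤ → S) (h : i + 3 * m ≤ j) :
    encodeAt code c i x j = x j := by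
  rw [encodeAt, dif_neg (by omega), if_neg (by omega)]

theorem encodeAt_add (i : ℤ) (x : ℤ → S) (k : Fin (3 * m)) :
    encodeAt code c i x (i + k) =
      code.symm (⟨stairAt f m i x, stairAt_mem i x⟩, c) k :=
  (dif_pos (by omega)).trans (congrArg _ (Fin.ext (by simp)))

/-- The block rule performing a transition of encoded stairs. -/
noncomputable def stepRule (code : (Fin (3 * m) → S) ≃ rightStairs f m × C)
    (Φ : rightStairs f m × S ≃ S × rightStairs f m) : Equiv.Perm (Fin (3 * m + 1) → S) :=
  (Fin.snocEquiv fun _ => S).symm.trans <|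
    ((Equiv.refl S).prodCongr code).trans <|
    (Equiv.prodAssoc _ _ _).symm.trans <|
    (((Equiv.prodComm _ _).trans Φ).prodCongr (Equiv.refl C)).trans <|
    (Equiv.prodAssoc _ _ _).trans <|
    ((Equiv.refl S).prodCongr code.symm).trans (Fin.consEquiv fun _ => S)

theorem stepRule_snoc {Φ : rightStairs f m × S ≃ S × rightStairs f m} {s s' : rightStairs f m}
    {a b : S} (h : Φ (s, a) = (b, s')) :
    stepRule code Φ (Fin.snoc (code.symm (s, c)) a) = Fin.cons b (code.symm (s', c)) := by
  have e : (Fin.snocEquiv fun _ => S).symm (Fin.snoc (code.symm (s, c)) a) =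
      (a, code.symm (s, c)) :=
    (Fin.snocEquiv fun _ => S).symm_apply_apply (a, code.symm (s, c))
  simp only [stepRule, Equiv.trans_apply, e]
  simp [h, Fin.consEquiv]

/-- The stored stair advances by one step, its output cell is left behind and the next cell of `x`
is absorbed; the label `c` is carried along unchanged. -/
theorem HasRadius.applyAt_stepRule [Nonempty S] (hr : HasRadius f r) (hm : r < m)
    {Φ : rightStairs f m × S ≃ S × rightStairs f m} (hΦ : ⇑Φ = stairStep f m) (i : ℤ)
    (x : ℤ → S) :
    applyAt (stepRule code Φ) i (encodeAt code c i x) = encodeAt code c (i + 1) x := by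
  refine applyAt_eq (fun j hj => ?_) ?_
  · rcases lt_or_ge j i with h | h
    · rw [encodeAt_of_lt _ h, encodeAt_of_lt _ (by omega)]
    · push_cast at hj
      rw [encodeAt_of_le _ (by omega), encodeAt_of_le _ (by omega)]
  · have h1 : (fun k : Fin (3 * m + 1) => encodeAt code c i x (i + (k : ℕ))) =
        Fin.snoc (code.symm (⟨stairAt f m i x, stairAt_mem i x⟩, c)) (x (i + 3 * m)) := by
      funext k
      induction k using Fin.lastCases with
      | last =>
        rw [Fin.snoc_last, encodeAt_of_le _ (by simp)]
        simp
      | cast k => simpa using encodeAt_add i x k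
    have h2 : (fun k : Fin (3 * m + 1) => encodeAt code c (i + 1) x (i + (k : ℕ))) =
        Fin.cons (f x i) (code.symm (⟨stairAt f m (i + 1) x, stairAt_mem (i + 1) x⟩, c)) := by
      funext k
      induction k using Fin.cases with
      | zero => simpa using encodeAt_of_lt x (by simp)
      | succ k =>
        rw [Fin.cons_succ, ← encodeAt_add, Fin.val_succ]
        congr 1
        push_cast
        ring
    rw [h1, h2]
    exact stepRule_snoc ((congrFun hΦ _).trans (hr.stairStep_eq hm i x))

theorem HasRadius.sweepRight_stepRule [Nonempty S] (hr : HasRadius f r) (hm : r < m)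
    {Φ : rightStairs f m × S ≃ S × rightStairs f m} (hΦ : ⇑Φ = stairStep f m) (i : ℤ)
    (x : ℤ → S) (k : ℕ) :
    sweepRight (stepRule code Φ) i k (encodeAt code c i x) = encodeAt code c (i + k) x := by
  induction k with
  | zero => simp [sweepRight]
  | succ k ih =>
    rw [sweepRight, ih, hr.applyAt_stepRule hm hΦ]
    push_cast
    rw [add_assoc]

theorem HasRadius.sweepLeft_stepRule [Nonempty S] (hr : HasRadius f r) (hm : r < m)
    {Φ : rightStairs f m × S ≃ S × rightStairs f m} (hΦ : ⇑Φ = stairStep f m) (i : ℤ)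
    (x : ℤ → S) (k : ℕ) :
    sweepLeft (stepRule code Φ).symm i k (encodeAt code c i x) = encodeAt code c (i - k) x := by
  induction k with
  | zero => simp [sweepLeft]
  | succ k ih =>
    have e := hr.applyAt_stepRule (code := code) (c := c) hm hΦ (i - ((k : ℤ) + 1)) x
    rw [show i - ((k : ℤ) + 1) + 1 = i - k by ring] at e
    rw [sweepLeft, ih, ← e, applyAt_symm_applyAt]
    push_cast
    rfl

theorem HasRadius.slidesAlong_stepRule [Finite S] [Nonempty S] [Nonempty C]
    (hr : HasRadius f r) (hm : r < m) {Φ : rightStairs f m × S ≃ S × rightStairs f m}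
    (hΦ : ⇑Φ = stairStep f m) : SlidesAlong f (stepRule code Φ) := by
  have hR : ∀ c i x, rightLim (stepRule code Φ) i (encodeAt code c i x) = f x := by
    intro c i x
    funext j
    rw [rightLim, hr.sweepRight_stepRule hm hΦ, encodeAt_of_lt _ (by omega)]
  have hL : ∀ c i x, leftLim (stepRule code Φ).symm i (encodeAt code c i x) = x := by
    intro c i x
    funext j
    rw [leftLim_apply (k := (i + (3 * m + 1 : ℕ) - j).toNat) _ (by omega),
      hr.sweepLeft_stepRule hm hΦ, encodeAt_of_le _ (by omega)]
  refine ⟨fun i u => ?_, fun i x => ⟨_, hL (Classical.arbitrary C) i x⟩⟩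
  obtain ⟨x, h1, h2, h3⟩ := hr.exists_stairAt_connecting hm (hΦ ▸ Φ.surjective) i
    (code fun k => u (i + k)).1 u u
  -- Every configuration `u` is an encoding: decode its block into a stair and a label, and join
  -- that stair to the tails of `u`. Thus the sweep formulas for encodings cover all starting
  -- configurations.
  have hu : encodeAt code (code fun k => u (i + k)).2 i x = u := by
    funext j
    rcases lt_or_ge j i with hj | hj
    · rw [encodeAt_of_lt _ hj, h3 j hj]
    · rcases lt_or_ge j (i + 3 * m) with hj' | hj'
      · have e : (⟨stairAt f m i x, stairAt_mem i x⟩ : rightStairs f m) =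
            (code fun k => u (i + k)).1 := Subtype.ext h1
        have := encodeAt_add (code := code) (c := (code fun k => u (i + k)).2) i x
          ⟨(j - i).toNat, by omega⟩
        rw [e, Prod.mk.eta, Equiv.symm_apply_apply] at this
        simpa only [Int.toNat_of_nonneg (sub_nonneg.2 hj), add_sub_cancel] using this
      · rw [encodeAt_of_le _ hj', h2 j hj']
  rw [← hu, hL, hR]

end Encoding

theorem HasRadius.exists_slidesAlong [Finite S] [Nonempty S] (hr : HasRadius f r) (hm : r < m)
    (hinj : Function.Injective (stairStep f m)) {N : ℕ}
    (hN : N * (rightStairs f m).ncard = Nat.card S ^ (3 * m)) :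
    ∃ χ : Equiv.Perm (Fin (3 * m + 1) → S), SlidesAlong f χ := by
  -- The label set `Fin N` must be inhabited for some encoding of each `x` to exist.
  have hN0 : N ≠ 0 := by
    rintro rfl
    rw [zero_mul] at hN
    exact (pow_pos Nat.card_pos _).ne hN
  have : NeZero N := ⟨hN0⟩
  have hcard : Nat.card (Fin (3 * m) → S) = Nat.card (rightStairs f m × Fin N) := by
    rw [Nat.card_prod, Nat.card_coe_set_eq, Nat.card_fin, Nat.card_fun, Nat.card_fin, ← hN,
      mul_comm]
  obtain ⟨code⟩ := Finite.card_eq.1 hcard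
  exact ⟨_, hr.slidesAlong_stepRule (code := code) hm
    (Φ := Equiv.ofBijective _ (stairStep_bijective_of_injective hinj)) rfl⟩

/-! ### The main theorem -/

theorem padicValRat_le_zero_of_mul_eq {a b N : ℕ} (ha : a ≠ 0) (h : N * a = b) (hb : b ≠ 0)
    (p : ℕ) (hp : p.Prime) : padicValRat p ((a : ℚ) / b) ≤ 0 := by
  have := Fact.mk hp
  subst h
  rw [padicValRat.div (by exact_mod_cast ha) (by exact_mod_cast hb), padicValRat.of_nat,
    padicValRat.of_nat, padicValNat.mul (left_ne_zero_of_mul hb) ha,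
    Nat.cast_add]
  omega

theorem exists_mul_eq_of_padicValRat_le_zero {a b : ℕ} (ha : a ≠ 0) (hb : b ≠ 0)
    (h : ∀ p : ℕ, p.Prime → padicValRat p ((a : ℚ) / b) ≤ 0) : ∃ N, N * a = b := by
  suffices hd : a ∣ b by
    obtain ⟨N, rfl⟩ := hd
    exact ⟨N, mul_comm _ _⟩
  rw [← Nat.factorization_le_iff_dvd ha hb]
  intro p
  by_cases hp : p.Prime
  · have := Fact.mk hp
    have h1 := h p hp
    rw [padicValRat.div (by exact_mod_cast ha) (by exact_mod_cast hb), padicValRat.of_nat,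
      padicValRat.of_nat] at h1
    rw [Nat.factorization_def _ hp, Nat.factorization_def _ hp]
    omega
  · simp [Nat.factorization_eq_zero_of_not_prime _ hp]

end SliderCA

theorem mainTheorem1 {S : Type*} [Finite S] [Nonempty S] [TopologicalSpace S] [DiscreteTopology S]
    (f : (ℤ → S) → (ℤ → S)) :
    (SliderCA.IsCellularAutomaton f → SliderCA.IsLeftClosing f →
      0 < SliderCA.stairLimit f ∧
        ∀ᶠ m : ℕ in Filter.atTop, SliderCA.stairRatio f m = SliderCA.stairLimit f) ∧
    (SliderCA.IsSlider f ↔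
      SliderCA.IsCellularAutomaton f ∧ SliderCA.IsLeftClosing f ∧
        ∀ p : ℕ, p.Prime → padicValRat p (SliderCA.stairLimit f) ≤ 0) := by
  have hS : ∀ k : ℕ, Nat.card S ^ k ≠ 0 := fun k => (pow_pos Nat.card_pos k).ne'
  refine ⟨fun hca hlc => ?_, ?_, ?_⟩
  · obtain ⟨r, hr⟩ := hca.exists_hasRadius
    have hev := hr.eventually_stairRatio_eq hlc
    obtain ⟨m, hm⟩ := hev.exists
    exact ⟨hm ▸ SliderCA.stairRatio_pos, hev⟩
  · rintro ⟨n, χ, hχ⟩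
    have hs := SliderCA.slidesAlong_iff.1 hχ
    obtain ⟨r, hr⟩ := hs.exists_hasRadius
    have hlc : SliderCA.IsLeftClosing f :=
      hr.isLeftClosing_of_injective (m := max n (r + 1)) (by omega)
        (SliderCA.stairStep_bijective_of_surjective
          (hs.stairStep_surjective hr (by omega) (by omega))).1
    refine ⟨hr.isCellularAutomaton, hlc, fun p hp => ?_⟩
    -- A single `m` suffices: the limit is attained there, so divisibility at this length bounds its
    -- valuations.
    obtain ⟨m, hm, hmn, hmr⟩ := ((hr.eventually_stairRatio_eq hlc).and
      ((eventually_ge_atTop n).and (eventually_gt_atTop r))).exists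
    obtain ⟨N, hN⟩ := hs.exists_card_eq hr hmn hmr
    have := SliderCA.padicValRat_le_zero_of_mul_eq SliderCA.ncard_rightStairs_pos.ne' hN (hS _)
      p hp
    rwa [Nat.cast_pow, ← SliderCA.stairRatio, hm] at this
  · rintro ⟨hca, hlc, hp⟩
    obtain ⟨r, hr⟩ := hca.exists_hasRadius
    obtain ⟨m, hm, hmr, hinj⟩ := ((hr.eventually_stairRatio_eq hlc).and
      (hr.eventually_stairStep_injective hlc)).exists
    obtain ⟨N, hN⟩ := SliderCA.exists_mul_eq_of_padicValRat_le_zero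
      (SliderCA.ncard_rightStairs_pos (f := f) (m := m)).ne' (hS (3 * m)) (fun p hp' => by
        rw [Nat.cast_pow, ← SliderCA.stairRatio, hm]
        exact hp p hp')
    obtain ⟨χ, hχ⟩ := hr.exists_slidesAlong hmr hinj hN
    exact ⟨_, χ, SliderCA.slidesAlong_iff.2 hχ⟩
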